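/- For $\delta\in\mathbb R$ let $\mathbb H_\delta=\{z\in\mathbb C:\operatorname{Re} z>\delta\}$ and let $\mathbb D$ be the open unit disc. For a positive semi-definite kernel $\kappa:\Omega\times\Omega\to\mathbb C$, let $\mathscr H_\kappa$ be its reproducing kernel Hilbert space; a function $\varphi:\Omega\to\mathbb C$ is a multiplier of $\mathscr H_\kappa$ if $f\mapsto\varphi f$ is a bounded operator on $\mathscr H_\kappa$, and its multiplier norm is the norm of this operator. The kernel $\kappa$ has the $n$-point scalar Pick property if, for all distinct $\lambda_1,\dots,\lambda_n\in\Omega$ and all $w_1,\dots,w_n\in\mathbb D$ such that the matrix $[(1-w_j\overline{w}_k)\kappa(\lambda_j,\lambda_k)]_{j,k=1}^n$ is positive semi-definite, there is a multiplier $\varphi$ of $\mathscr H_\kappa$ of norm at most one with $\varphi(\lambda_j)=w_j$ for $j=1,\dots,n$. Let $p_1<p_2<\cdots$ be the prime numbers and, for $n\ge 1$, let $\mathcal P_n=\{p_1^{m_1}\cdots p_n^{m_n}: m_1,\dots,m_n\ge 0\}$. **Proposition 2.3.** Let $\mathbf a=\{a_m\}_{m=1}^\infty$ be a sequence of positive real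 numbers such that $$\sum_{j\in\mathcal P_n}a_j\,j^{-\sigma}<\infty\qquad\text{for every }\sigma>0\text{ and every }n\ge 1,$$ and such that the series $$\kappa_{\mathbf a}(s,u)=\sum_{m=1}^\infty a_m m^{-s-\overline u}$$ converges for all $s,u\in\mathbb H_{1/2}$, so that it defines a positive semi-definite kernel $\kappa_{\mathbf a}$ on $\mathbb H_{1/2}$. Assume that there are distinct points $\lambda_1,\lambda_2\in\mathbb H_{1/2}$ and $w_1,w_2\in\mathbb D$ such that $$\big[(1-\overline w_iw_j)\,\kappa_{\mathbf a}(\lambda_j,\lambda_i)\big]_{i,j=1}^2\ \text{is positive semi-definite and}\ \Big[\frac{1-\overline w_iw_j}{\overline\lambda_i+\lambda_j}\Big]_{i,j=1}^2\ \text{is not positive semi-definite.}$$ Then $\kappa_{\mathbf a}$ does not have the $2$-point scalar Pick property. -/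

import Mathlib

open ComplexConjugate
open scoped ComplexOrder

/-- The open right half-plane `{σ + it : σ > δ}`. -/
def halfPlane (δ : ℝ) : Set ℂ := {z | δ < z.re}

/-- A scalar-valued kernel `κ` on `X`, regarded as an operator-valued kernel: the entry at `(x, y)`
is multiplication by `κ(x, y)` on `ℂ`. -/
noncomputable def operatorKernel {X : Type*} (κ : Matrix X X ℂ) : Matrix X X (ℂ →L[ℂ] ℂ) :=
  Matrix.of fun x y => κ x y • ContinuousLinearMap.id ℂ ℂ

theorem operatorKernel_posSemidef {X : Type*} {κ : Matrix X X ℂ} (hκ : κ.PosSemidef) :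
    (operatorKernel κ).PosSemidef := by
  have key := (RKHS.posSemidef_tfae (K := operatorKernel κ)).out 0 2
  refine key.mpr ⟨?_, fun v => ?_⟩
  · ext x y
    have h1 : star (ContinuousLinearMap.id ℂ ℂ) = ContinuousLinearMap.id ℂ ℂ := star_one _
    simp [operatorKernel, Matrix.conjTranspose_apply, ← hκ.isHermitian.apply x y, h1]
  · have h := (Complex.nonneg_iff.mp (hκ.2 v)).1
    convert h using 1
    change Complex.re _ = _
    congr 1
    refine Finsupp.sum_congr fun x _ => Finsupp.sum_congr fun y _ => ?_
    rw [← hκ.isHermitian.apply x y]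
    simp [operatorKernel]
    ring

/-- The reproducing kernel Hilbert space of complex-valued functions on `X` associated with a
positive semi-definite kernel `κ`. -/
noncomputable abbrev KernelSpace {X : Type*} (κ : Matrix X X ℂ) (hκ : κ.PosSemidef) : Type _ :=
  haveI : Fact (operatorKernel κ).PosSemidef := ⟨operatorKernel_posSemidef hκ⟩
  RKHS.OfKernel (operatorKernel κ)

/-- `φ` is a multiplier of norm at most one of the Hilbert function space `H`: multiplication by
`φ` is a bounded operator on `H`, of operator norm at most one. -/
def IsContractiveMultiplier {X : Type*} (H : Type*) [NormedAddCommGroup H] [InnerProductSpace ℂ H]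
    [RKHS ℂ H X ℂ] (φ : X → ℂ) : Prop :=
  ∃ M : H →L[ℂ] H, (∀ (f : H) (x : X), (M f) x = φ x * f x) ∧ ‖M‖ ≤ 1

/-- The `n`-point scalar Pick property of a positive semi-definite kernel `κ` on `X`. -/
def HasScalarPickProperty {X : Type*} (κ : Matrix X X ℂ) (hκ : κ.PosSemidef) (n : ℕ) : Prop :=
  ∀ (lam : Fin n → X) (w : Fin n → ℂ), Function.Injective lam → (∀ j, ‖w j‖ < 1) →
    (Matrix.of fun j k => (1 - w j * conj (w k)) * κ (lam j) (lam k)).PosSemidef →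
    ∃ φ : X → ℂ, IsContractiveMultiplier (KernelSpace κ hκ) φ ∧ ∀ j, φ (lam j) = w j

/-- The set of integers `p₁ ^ m₁ ⋯ pₙ ^ mₙ` with `m₁, …, mₙ ≥ 0`, where `p₁ < p₂ < ⋯` are
the prime numbers. -/
def smoothIntegers (n : ℕ) : Set ℕ+ :=
  {j | ∃ e : Fin n → ℕ, (j : ℕ) = ∏ i : Fin n, Nat.nth Nat.Prime i ^ e i}

/-- The diagonal Dirichlet series kernel `κ(s, u) = ∑_{m ≥ 1} a_m m ^ (-s - ū)` on the half-plane
`{Re s > 1/2}`. -/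
noncomputable def dirichletKernel (a : ℕ+ → ℝ) :
    Matrix (halfPlane (1 / 2)) (halfPlane (1 / 2)) ℂ :=
  Matrix.of fun s u => ∑' m : ℕ+, (a m : ℂ) * (m : ℂ) ^ (-(s : ℂ) - conj (u : ℂ))

theorem dirichletKernel_posSemidef {a : ℕ+ → ℝ} (ha : ∀ m, 0 < a m)
    (hconv : ∀ s u : halfPlane (1 / 2),
      Summable fun m : ℕ+ => (a m : ℂ) * (m : ℂ) ^ (-(s : ℂ) - conj (u : ℂ))) :
    (dirichletKernel a).PosSemidef := by
  have hfac : ∀ (s u : halfPlane (1 / 2)) (m : ℕ+),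
      (a m : ℂ) * (m : ℂ) ^ (-(s : ℂ) - conj (u : ℂ)) =
        a m * ((m : ℂ) ^ (-(s : ℂ)) * conj ((m : ℂ) ^ (-(u : ℂ)))) := by
    intro s u m
    have hm : (m : ℂ) ≠ 0 := by exact_mod_cast m.ne_zero
    have h1 : (m : ℂ) ^ (conj (-(u : ℂ))) = conj ((conj (m : ℂ)) ^ (-(u : ℂ))) :=
      Complex.cpow_conj _ _ (by rw [Complex.natCast_arg]; exact Real.pi_ne_zero.symm)
    rw [sub_eq_add_neg, Complex.cpow_add _ _ hm, ← map_neg, h1, Complex.conj_natCast]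
  refine ⟨?_, fun x => ?_⟩
  · ext s u
    simp only [Matrix.conjTranspose_apply, dirichletKernel, Matrix.of_apply, hfac, RCLike.star_def]
    rw [Complex.conj_tsum]
    refine tsum_congr fun m => ?_
    simp [mul_comm]
  · have h : HasSum (fun m : ℕ+ => (a m : ℂ) *
        (star (x.sum fun i xi => xi * conj ((m : ℂ) ^ (-(i : ℂ)))) *
          (x.sum fun i xi => xi * conj ((m : ℂ) ^ (-(i : ℂ))))))
        (x.sum fun i xi => x.sum fun j xj => star xi * dirichletKernel a i j * xj) := by
      refine HasSum.congr_fun (f := fun m : ℕ+ => ∑ i ∈ x.support, ∑ j ∈ x.support,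
        star (x i) * ((a m : ℂ) * (m : ℂ) ^ (-(i : ℂ) - conj (j : ℂ))) * x j)
        (hasSum_sum fun i _ => hasSum_sum fun j _ =>
          ((hconv i j).hasSum.mul_left (star (x i))).mul_right (x j)) ?_
      intro m
      simp only [Finsupp.sum, star_sum, hfac]
      rw [Finset.sum_mul_sum, Finset.mul_sum]
      simp only [Finset.mul_sum]
      refine Finset.sum_congr rfl fun i _ => Finset.sum_congr rfl fun j _ => ?_
      simp
      ring
    exact h.nonneg fun m => mul_nonneg (by exact_mod_cast (ha m).le) (star_mul_self_nonneg _)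

/-! The Pick property would turn the given data into a contractive multiplier `φ` with `φ (lam j) =
w j`. Such a `φ` is a Dirichlet series `∑ c_m m ^ (-s)` on `Re s > 1/2`; the point is that it obeys
the Schwarz–Pick inequality of the larger half-plane `Re s > 0`, which for two points says exactly
that the excluded Pick matrix is positive semi-definite. To reach the larger half-plane, model
multiplication by `φ` as a contraction `T` on `ℓ²` and truncate to the indices in `smoothIntegers
n`. These are closed under products and divisors, so a truncated feature vector is still an
eigenvector of `T.adjoint`, with eigenvalue the conjugate of the truncated symbol `F n`
(`adjoint_dirichletFeature_smooth`). The growth hypothesis puts these vectors in `ℓ²` for all `Re z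
> 0`, hence `F n` is analytic there and bounded by `1`. Schwarz–Pick for `F n` passes to the limit
`F n → φ` at the two points. -/

/-! ### Transfer of multipliers to an arbitrary feature space. -/

theorem norm_linearCombination_eq_of_inner_eq {X E F : Type*} [NormedAddCommGroup E]
    [InnerProductSpace ℂ E] [NormedAddCommGroup F] [InnerProductSpace ℂ F] {v : X → E} {k : X → F}
    (h : ∀ x y, inner ℂ (v x) (v y) = inner ℂ (k x) (k y)) (c : X →₀ ℂ) :
    ‖Finsupp.linearCombination ℂ v c‖ = ‖Finsupp.linearCombination ℂ k c‖ := by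
  have key : inner ℂ (Finsupp.linearCombination ℂ v c) (Finsupp.linearCombination ℂ v c) =
      inner ℂ (Finsupp.linearCombination ℂ k c) (Finsupp.linearCombination ℂ k c) := by
    simp only [Finsupp.linearCombination_apply, Finsupp.sum, sum_inner, inner_sum, inner_smul_left,
      inner_smul_right, h]
  rw [← sq_eq_sq₀ (norm_nonneg _) (norm_nonneg _), ← inner_self_eq_norm_sq (𝕜 := ℂ),
    ← inner_self_eq_norm_sq (𝕜 := ℂ), key]

theorem denseRange_linearCombination_of_inner_eq_zero {X E : Type*} [NormedAddCommGroup E]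
    [InnerProductSpace ℂ E] [CompleteSpace E] {v : X → E}
    (hv : ∀ f : E, (∀ x, inner ℂ (v x) f = 0) → f = 0) :
    DenseRange (Finsupp.linearCombination ℂ v) := by
  have h : (LinearMap.range (Finsupp.linearCombination ℂ v)).topologicalClosure = ⊤ := by
    rw [Submodule.topologicalClosure_eq_top_iff, Submodule.eq_bot_iff]
    intro f hf
    refine hv f fun x => Submodule.inner_right_of_mem_orthogonal ?_ hf
    exact ⟨Finsupp.single x 1, by simp⟩
  have h2 := Submodule.dense_iff_topologicalClosure_eq_top.mpr h
  exact h2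

/-- A contractive multiplier of a kernel space induces a contraction on every Hilbert space
carrying a total feature map for the kernel. -/
theorem IsContractiveMultiplier.exists_contraction {X E : Type*} [NormedAddCommGroup E]
    [InnerProductSpace ℂ E] [CompleteSpace E] {κ : Matrix X X ℂ} {hκ : κ.PosSemidef} {φ : X → ℂ}
    (hφ : IsContractiveMultiplier (KernelSpace κ hκ) φ) {v : X → E}
    (hker : ∀ x y, inner ℂ (v x) (v y) = κ x y)
    (hv : ∀ f : E, (∀ x, inner ℂ (v x) f = 0) → f = 0) :
    ∃ T : E →L[ℂ] E, ‖T‖ ≤ 1 ∧ ∀ x f, inner ℂ (v x) (T f) = φ x * inner ℂ (v x) f := by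
  have : Fact (operatorKernel κ).PosSemidef := ⟨operatorKernel_posSemidef hκ⟩
  obtain ⟨M, hM, hM1⟩ := hφ
  let k : X → KernelSpace κ hκ := fun x => RKHS.kerFun (KernelSpace κ hκ) x 1
  have hk : ∀ x y, inner ℂ (k x) (k y) = κ x y := by
    intro x y
    have h := RKHS.kernel_inner (𝕜 := ℂ) (KernelSpace κ hκ) y x (1 : ℂ) (1 : ℂ)
    change inner ℂ (RKHS.kerFun (KernelSpace κ hκ) x 1) (RKHS.kerFun (KernelSpace κ hκ) y 1) = _
    rw [← h, RKHS.OfKernel.kernel_ofKernel]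
    simp only [operatorKernel, Matrix.of_apply, ← hκ.isHermitian.apply x y]
    simp
  have hadj : ∀ x, M.adjoint (k x) = conj (φ x) • k x := by
    intro x
    refine ext_inner_left ℂ fun f => ?_
    rw [ContinuousLinearMap.adjoint_inner_right, inner_smul_right]
    change inner ℂ (M f) (RKHS.kerFun (KernelSpace κ hκ) x 1) =
      _ * inner ℂ f (RKHS.kerFun (KernelSpace κ hκ) x 1)
    rw [RKHS.inner_kerFun, RKHS.inner_kerFun, hM]
    simp
  have hbound : ∀ c : X →₀ ℂ, ‖Finsupp.linearCombination ℂ (fun x => conj (φ x) • v x) c‖ ≤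
      1 * ‖Finsupp.linearCombination ℂ v c‖ := by
    intro c
    have h1 := norm_linearCombination_eq_of_inner_eq (v := fun x => conj (φ x) • v x)
      (k := fun x => conj (φ x) • k x)
      (fun x y => by simp only [inner_smul_left, inner_smul_right, hk, hker]) c
    have h2 := norm_linearCombination_eq_of_inner_eq (v := v) (k := k)
      (fun x y => by rw [hk, hker]) c
    rw [h1, h2]
    have : Finsupp.linearCombination ℂ (fun x => conj (φ x) • k x) c =
        M.adjoint (Finsupp.linearCombination ℂ k c) := by
      simp only [Finsupp.linearCombination_apply, Finsupp.sum, map_sum, map_smul, hadj]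
    rw [this]
    refine (M.adjoint.le_opNorm _).trans ?_
    gcongr
    simpa using hM1
  have hd := denseRange_linearCombination_of_inner_eq_zero hv
  -- `S` plays the role of `M.adjoint`, for which kernel functions are eigenvectors; `hbound` makes
  -- `v x ↦ conj (φ x) • v x` well defined and contractive on the dense span.
  let S : E →L[ℂ] E := (Finsupp.linearCombination ℂ (fun x => conj (φ x) • v x)).extendOfNorm
    (Finsupp.linearCombination ℂ v)
  have hS1 : ‖S‖ ≤ 1 := LinearMap.opNorm_extendOfNorm_le hd zero_le_one hbound
  have hS : ∀ x, S (v x) = conj (φ x) • v x := by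
    intro x
    have := LinearMap.extendOfNorm_eq hd ⟨1, hbound⟩ (Finsupp.single x 1)
    simpa using this
  refine ⟨S.adjoint, by simpa using hS1, fun x f => ?_⟩
  rw [ContinuousLinearMap.adjoint_inner_right, hS, inner_smul_left]
  simp

/-! ### Schwarz–Pick on the half-plane and the two-point Pick matrix. -/

theorem Complex.norm_one_sub_conj_mul_sq_sub (w z : ℂ) :
    ‖1 - conj w * z‖ ^ 2 - ‖z - w‖ ^ 2 = (1 - ‖w‖ ^ 2) * (1 - ‖z‖ ^ 2) := by
  simp only [Complex.sq_norm, Complex.normSq_apply]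
  simp
  ring

theorem Complex.norm_add_conj_sq_sub (w z : ℂ) :
    ‖conj w + z‖ ^ 2 - ‖z - w‖ ^ 2 = 4 * w.re * z.re := by
  simp only [Complex.sq_norm, Complex.normSq_apply]
  simp
  ring

theorem Complex.one_sub_conj_mul_ne_zero {w z : ℂ} (hw : ‖w‖ < 1) (hz : ‖z‖ ≤ 1) :
    1 - conj w * z ≠ 0 := by
  intro h
  have h1 : ‖conj w * z‖ = 1 := by rw [← sub_eq_zero.mp h, norm_one]
  rw [norm_mul, Complex.norm_conj] at h1
  nlinarith [norm_nonneg w, norm_nonneg z]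

/-- The **Schwarz–Pick inequality** for maps from the right half-plane to the closed disc. -/
theorem Complex.schwarz_pick_halfPlane {f : ℂ → ℂ} (hd : DifferentiableOn ℂ f {z | 0 < z.re})
    (hf : ∀ z : ℂ, 0 < z.re → ‖f z‖ ≤ 1) {p z : ℂ} (hp : 0 < p.re) (hz : 0 < z.re)
    (hfp : ‖f p‖ < 1) :
    ‖f z - f p‖ * ‖conj p + z‖ ≤ ‖z - p‖ * ‖1 - conj (f p) * f z‖ := by
  have hne : conj p + z ≠ 0 := by
    intro h
    have := congrArg Complex.re h
    simp at this
    linarith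
  have hone : ∀ ζ : ℂ, ‖ζ‖ < 1 → 1 - ζ ≠ 0 := by
    intro ζ hζ h
    rw [← sub_eq_zero.mp h, norm_one] at hζ
    exact lt_irrefl _ hζ
  -- Cayley map from the disc to the half-plane sending `0` to `p`; its inverse is `z ↦ (z - p) /
  -- (conj p + z)`.
  have hcay : ∀ ζ : ℂ, ‖ζ‖ < 1 → 0 < ((p + conj p * ζ) / (1 - ζ)).re := by
    intro ζ hζ
    have hN : 0 < Complex.normSq (1 - ζ) := Complex.normSq_pos.mpr (hone ζ hζ)
    have h1 : ((p + conj p * ζ) / (1 - ζ)).re =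
        p.re * (1 - ‖ζ‖ ^ 2) / Complex.normSq (1 - ζ) := by
      rw [Complex.div_re, Complex.sq_norm, ← add_div]
      congr 1
      simp [Complex.normSq_apply]
      ring
    rw [h1]
    have : ‖ζ‖ ^ 2 < 1 := by nlinarith [norm_nonneg ζ]
    have h2 : 0 < 1 - ‖ζ‖ ^ 2 := by linarith
    positivity
  -- A disc automorphism moves `f p` to `0`, so that the Schwarz lemma applies to `g`.
  let g : ℂ → ℂ := fun ζ => (f ((p + conj p * ζ) / (1 - ζ)) - f p) /
    (1 - conj (f p) * f ((p + conj p * ζ) / (1 - ζ)))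
  have hball : ∀ ζ ∈ Metric.ball (0 : ℂ) 1, ‖ζ‖ < 1 := fun ζ h => by simpa using h
  have hdc : DifferentiableOn ℂ (fun ζ => f ((p + conj p * ζ) / (1 - ζ))) (Metric.ball 0 1) := by
    refine hd.comp ?_ fun ζ hζ => hcay ζ (hball ζ hζ)
    refine DifferentiableOn.div (by fun_prop) (by fun_prop) fun ζ hζ => hone ζ (hball ζ hζ)
  have hgd : DifferentiableOn ℂ g (Metric.ball 0 1) := by
    refine DifferentiableOn.div (hdc.sub_const _) ((hdc.const_mul _).const_sub _) fun ζ hζ => ?_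
    exact Complex.one_sub_conj_mul_ne_zero hfp (hf _ (hcay ζ (hball ζ hζ)))
  have hgm : Set.MapsTo g (Metric.ball 0 1) (Metric.closedBall 0 1) := by
    intro ζ hζ
    have hfζ := hf _ (hcay ζ (hball ζ hζ))
    have hpos := norm_pos_iff.mpr (Complex.one_sub_conj_mul_ne_zero hfp hfζ)
    rw [mem_closedBall_zero_iff, norm_div, div_le_one hpos, ← sq_le_sq₀ (norm_nonneg _) hpos.le]
    have h1 := Complex.norm_one_sub_conj_mul_sq_sub (f p) (f ((p + conj p * ζ) / (1 - ζ)))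
    have h2 : 0 ≤ (1 - ‖f p‖ ^ 2) * (1 - ‖f ((p + conj p * ζ) / (1 - ζ))‖ ^ 2) :=
      mul_nonneg (by nlinarith [norm_nonneg (f p)]) (by nlinarith [norm_nonneg (f ((p + conj p * ζ) / (1 - ζ)))])
    linarith
  have hζ : ‖(z - p) / (conj p + z)‖ < 1 := by
    rw [norm_div, div_lt_one (norm_pos_iff.mpr hne),
      ← sq_lt_sq₀ (norm_nonneg _) (norm_nonneg _)]
    have h1 := Complex.norm_add_conj_sq_sub p z
    have : 0 < 4 * p.re * z.re := by positivity
    linarith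
  have hback : (p + conj p * ((z - p) / (conj p + z))) / (1 - (z - p) / (conj p + z)) = z := by
    have h1 := hone _ hζ
    rw [div_eq_iff h1]
    field_simp
    ring
  have h := Complex.norm_le_norm_of_mapsTo_ball hgd hgm (by simp [g]) hζ
  simp only [g, hback, norm_div] at h
  rwa [div_le_div_iff₀ (norm_pos_iff.mpr (Complex.one_sub_conj_mul_ne_zero hfp (hf z hz)))
    (norm_pos_iff.mpr hne)] at h

/-- Cholesky factorization: `q ^ 2` is the Schur complement of `A`, nonnegative by the determinant
condition. -/
theorem Matrix.posSemidef_fin_two_of_norm_sq_le {A C : ℝ} {B : ℂ} (hA : 0 < A)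
    (h : ‖B‖ ^ 2 ≤ A * C) : (!![(A : ℂ), B; conj B, (C : ℂ)]).PosSemidef := by
  set r := √A
  have hr0 : (r : ℂ) ≠ 0 := by exact_mod_cast (Real.sqrt_pos.mpr hA).ne'
  have hrr : (r : ℂ) * r = A := by exact_mod_cast Real.mul_self_sqrt hA.le
  have hC : 0 ≤ C - ‖B‖ ^ 2 / A := by
    rw [sub_nonneg, div_le_iff₀ hA]
    linarith
  set q := √(C - ‖B‖ ^ 2 / A)
  have hqq : (q : ℂ) * q = C - ‖B‖ ^ 2 / A := by exact_mod_cast Real.mul_self_sqrt hC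
  have hfac : !![(A : ℂ), B; conj B, (C : ℂ)] =
      Matrix.conjTranspose !![(r : ℂ), B / r; 0, (q : ℂ)] * !![(r : ℂ), B / r; 0, (q : ℂ)] := by
    ext i j
    fin_cases i <;> fin_cases j <;>
      simp [Matrix.mul_apply, Fin.sum_univ_two, Matrix.conjTranspose_apply, hrr, hqq]
    · field_simp
    · field_simp
    · rw [div_mul_div_comm, hrr, Complex.conj_mul']
      ring
  rw [hfac]
  exact Matrix.posSemidef_conjTranspose_mul_self _

/-- The two-point Pick matrix of the right half-plane is positive semi-definite as soon as the data
satisfy the Schwarz–Pick inequality. -/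
theorem pickMatrix_halfPlane_posSemidef {lam w : Fin 2 → ℂ} (hlam : ∀ i, 0 < (lam i).re)
    (hw : ∀ i, ‖w i‖ < 1)
    (h : ‖w 1 - w 0‖ * ‖conj (lam 0) + lam 1‖ ≤ ‖lam 1 - lam 0‖ * ‖1 - conj (w 0) * w 1‖) :
    (Matrix.of fun i j : Fin 2 =>
      (1 - conj (w i) * w j) / (conj (lam i) + lam j)).PosSemidef := by
  have hN : ∀ i, 0 < 1 - ‖w i‖ ^ 2 := fun i => by nlinarith [hw i, norm_nonneg (w i)]
  have hre : ∀ i, conj (lam i) + lam i = ((2 * (lam i).re : ℝ) : ℂ) := fun i => by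
    rw [add_comm, Complex.add_conj]
  have hnum : ∀ i, 1 - conj (w i) * w i = ((1 - ‖w i‖ ^ 2 : ℝ) : ℂ) := fun i => by
    rw [Complex.conj_mul']
    push_cast
    rfl
  have hmat : (Matrix.of fun i j : Fin 2 => (1 - conj (w i) * w j) / (conj (lam i) + lam j)) =
      !![(((1 - ‖w 0‖ ^ 2) / (2 * (lam 0).re) : ℝ) : ℂ),
        (1 - conj (w 0) * w 1) / (conj (lam 0) + lam 1);
        conj ((1 - conj (w 0) * w 1) / (conj (lam 0) + lam 1)),
        (((1 - ‖w 1‖ ^ 2) / (2 * (lam 1).re) : ℝ) : ℂ)] := by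
    ext i j
    fin_cases i <;> fin_cases j
    · simp [hre, hnum]
    · simp
    · simp [mul_comm, add_comm]
    · simp [hre, hnum]
  rw [hmat]
  have h0 := hlam 0
  have h1 := hlam 1
  refine Matrix.posSemidef_fin_two_of_norm_sq_le (div_pos (hN 0) (by positivity)) ?_
  have hs := Complex.norm_add_conj_sq_sub (lam 0) (lam 1)
  have hpos : 0 < ‖conj (lam 0) + lam 1‖ ^ 2 := by
    have : 0 < 4 * (lam 0).re * (lam 1).re := by positivity
    nlinarith [sq_nonneg ‖lam 1 - lam 0‖]
  have hsw := Complex.norm_one_sub_conj_mul_sq_sub (w 0) (w 1)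
  have hsq := pow_le_pow_left₀ (by positivity) h 2
  rw [mul_pow, mul_pow] at hsq
  rw [norm_div, div_pow, div_mul_div_comm, div_le_div_iff₀ hpos (by positivity)]
  -- With both products written as differences of squares, the common term cancels and the
  -- determinant condition becomes the square of `h`.
  have e1 : 2 * (lam 0).re * (2 * (lam 1).re) =
      ‖conj (lam 0) + lam 1‖ ^ 2 - ‖lam 1 - lam 0‖ ^ 2 := by rw [hs]; ring
  rw [e1, ← hsw]
  nlinarith

/-! ### Dirichlet series indexed by the positive integers. -/

/-- Extension by zero at `0` of a sequence indexed by the positive integers. -/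
def PNat.extendZero (f : ℕ+ → ℂ) (n : ℕ) : ℂ := if h : 0 < n then f ⟨n, h⟩ else 0

theorem PNat.extendZero_coe (f : ℕ+ → ℂ) (m : ℕ+) : PNat.extendZero f m = f m :=
  dif_pos m.pos

theorem PNat.term_extendZero (f : ℕ+ → ℂ) (s : ℂ) (m : ℕ+) :
    LSeries.term (PNat.extendZero f) s m = f m * (m : ℂ) ^ (-s) := by
  rw [LSeries.term_def₀ (by simp [PNat.extendZero]), PNat.extendZero_coe]

theorem PNat.lseriesHasSum_extendZero_iff {f : ℕ+ → ℂ} {s c : ℂ} :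
    LSeriesHasSum (PNat.extendZero f) s c ↔ HasSum (fun m : ℕ+ => f m * (m : ℂ) ^ (-s)) c := by
  simp only [← PNat.term_extendZero]
  rw [hasSum_pnat_iff (f := LSeries.term (PNat.extendZero f) s), LSeries.term_zero, add_zero]
  rfl

/-- Uniqueness of the coefficients of a Dirichlet series that vanishes on a real half-line. -/
theorem PNat.eq_zero_of_hasSum_dirichlet {f : ℕ+ → ℂ} {δ : ℝ}
    (h : ∀ x : ℝ, δ < x → HasSum (fun m : ℕ+ => f m * (m : ℂ) ^ (-(x : ℂ))) 0) : f = 0 := by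
  have h' : ∀ x : ℝ, δ < x → LSeriesHasSum (PNat.extendZero f) x 0 := fun x hx =>
    PNat.lseriesHasSum_extendZero_iff.mpr (h x hx)
  have habs : LSeries.abscissaOfAbsConv (PNat.extendZero f) ≠ ⊤ :=
    ne_top_of_le_ne_top (EReal.coe_ne_top _)
      (h' (δ + 1) (by linarith)).LSeriesSummable.abscissaOfAbsConv_le
  have hz : (fun x : ℝ => LSeries (PNat.extendZero f) x) =ᶠ[Filter.atTop] 0 := by
    filter_upwards [Filter.eventually_gt_atTop δ] with x hx
    exact (h' x hx).LSeries_eq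
  rcases LSeries_eventually_eq_zero_iff'.mp hz with h0 | h0
  · funext m
    rw [← PNat.extendZero_coe f m]
    exact h0 m m.ne_zero
  · exact absurd h0 habs

/-! ### Arithmetic of the smooth integers. -/

theorem mem_smoothIntegers_iff {n : ℕ} {j : ℕ+} :
    j ∈ smoothIntegers n ↔ ∀ p : ℕ, p.Prime → p ∣ j → ∃ i < n, Nat.nth Nat.Prime i = p := by
  have hprime : ∀ i, (Nat.nth Nat.Prime i).Prime := Nat.prime_nth_prime
  constructor
  · rintro ⟨e, he⟩ p hp hpj
    rw [he] at hpj
    obtain ⟨i, -, hi⟩ := (hp.prime.dvd_finsetProd_iff _).mp hpj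
    exact ⟨i, i.2, ((Nat.prime_dvd_prime_iff_eq hp (hprime i)).mp (hp.dvd_of_dvd_pow hi)).symm⟩
  · intro h
    refine ⟨fun i => (j : ℕ).factorization (Nat.nth Nat.Prime i), ?_⟩
    have hinj : Function.Injective (Nat.nth Nat.Prime) :=
      Nat.nth_injective Nat.infinite_setOfPred_prime
    rw [Fin.prod_univ_eq_prod_range
      (fun i => Nat.nth Nat.Prime i ^ (j : ℕ).factorization (Nat.nth Nat.Prime i)) n,
      ← Finset.prod_image (f := fun p => p ^ (j : ℕ).factorization p)
        (fun x _ y _ hxy => hinj hxy)]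
    conv_lhs => rw [← Nat.prod_factorization_pow_eq_self j.ne_zero]
    refine Finset.prod_subset ?_ ?_
    · intro p hp
      rw [Nat.support_factorization, Nat.mem_primeFactors] at hp
      obtain ⟨i, hi, hip⟩ := h p hp.1 hp.2.1
      exact Finset.mem_image.mpr ⟨i, Finset.mem_range.mpr hi, hip⟩
    · intro p _ hp
      simp [Finsupp.notMem_support_iff.mp hp]

theorem one_mem_smoothIntegers (n : ℕ) : 1 ∈ smoothIntegers n :=
  ⟨0, by simp⟩

theorem mul_mem_smoothIntegers_iff {n : ℕ} {j k : ℕ+} :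
    j * k ∈ smoothIntegers n ↔ j ∈ smoothIntegers n ∧ k ∈ smoothIntegers n := by
  simp only [mem_smoothIntegers_iff, PNat.mul_coe]
  refine ⟨fun h => ⟨fun p hp hd => h p hp (hd.mul_right _), fun p hp hd => h p hp (hd.mul_left _)⟩,
    fun h p hp hd => ?_⟩
  rcases (hp.dvd_mul).mp hd with hd | hd
  · exact h.1 p hp hd
  · exact h.2 p hp hd

theorem eventually_mem_smoothIntegers (j : ℕ+) :
    ∀ᶠ n in Filter.atTop, j ∈ smoothIntegers n := by
  filter_upwards [Filter.eventually_gt_atTop (j : ℕ)] with n hn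
  refine mem_smoothIntegers_iff.mpr fun p hp hd => ?_
  -- The zero-based index of a prime `p` is at most `p`, and `p ≤ j < n`.
  refine ⟨Nat.count Nat.Prime p, ?_, Nat.nth_count hp⟩
  exact ((Nat.count_le _).trans (Nat.le_of_dvd j.pos hd)).trans_lt hn

/-! ### The `ℓ²` model of the Dirichlet series space. -/

/-- The Hilbert space of square-summable sequences indexed by the positive integers. -/
abbrev PNatL2 : Type := lp (fun _ : ℕ+ => ℂ) 2

/-- The coordinate unit vectors of `PNatL2`. -/
noncomputable def PNatL2.unit (k : ℕ+) : PNatL2 := lp.single 2 k (1 : ℂ)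

theorem PNatL2.ext_inner_unit {x y : PNatL2}
    (h : ∀ k, inner ℂ x (PNatL2.unit k) = inner ℂ y (PNatL2.unit k)) : x = y := by
  refine lp.ext (funext fun k => ?_)
  have := h k
  rw [PNatL2.unit, lp.inner_single_right, lp.inner_single_right] at this
  simpa using congrArg conj this

/-- The feature vector at `z` of the kernel with weights `a`, restricted to the indices in `P`. -/
noncomputable def dirichletFeature (a : ℕ+ → ℝ) (P : Set ℕ+) (z : ℂ) : ℕ+ → ℂ :=
  P.indicator fun m => (√(a m) : ℂ) * conj ((m : ℂ) ^ (-z))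

theorem memℓp_dirichletFeature {a : ℕ+ → ℝ} (ha : ∀ m, 0 < a m) {P : Set ℕ+} {z : ℂ}
    (h : Summable fun m : P => a m * ((m : ℕ+) : ℝ) ^ (-(2 * z.re))) :
    Memℓp (dirichletFeature a P z) 2 := by
  rw [memℓp_gen_iff (by norm_num)]
  refine ((summable_subtype_iff_indicator
    (f := fun m : ℕ+ => a m * (m : ℝ) ^ (-(2 * z.re)))).mp h).congr fun m => ?_
  by_cases hm : m ∈ P
  · rw [dirichletFeature, Set.indicator_of_mem hm, Set.indicator_of_mem hm]
    have h1 : ‖(m : ℂ) ^ (-z)‖ = (m : ℝ) ^ (-z.re) := by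
      rw [Complex.norm_natCast_cpow_of_pos m.pos, Complex.neg_re]
    have h2 : (m : ℝ) ^ (-(2 * z.re)) = ((m : ℝ) ^ (-z.re)) ^ 2 := by
      rw [← Real.rpow_natCast, ← Real.rpow_mul (by positivity)]
      congr 1
      push_cast
      ring
    simp [h1, h2, mul_pow, Real.sq_sqrt (ha m).le]
  · simp [dirichletFeature, hm]

theorem inner_dirichletFeature_hasSum {a : ℕ+ → ℝ} {P : Set ℕ+} {z : ℂ}
    (h : Memℓp (dirichletFeature a P z) 2) (f : PNatL2) :
    HasSum (fun m => P.indicator (fun m : ℕ+ => (√(a m) : ℂ) * f m) m * (m : ℂ) ^ (-z))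
      (inner ℂ (⟨dirichletFeature a P z, h⟩ : PNatL2) f) := by
  refine (lp.hasSum_inner (⟨dirichletFeature a P z, h⟩ : PNatL2) f).congr_fun fun m => ?_
  change _ = inner ℂ (dirichletFeature a P z m) (f m)
  by_cases hm : m ∈ P
  · simp [dirichletFeature, hm]
    ring
  · simp [dirichletFeature, hm]

theorem inner_dirichletFeature_unit {a : ℕ+ → ℝ} {P : Set ℕ+} {z : ℂ}
    (h : Memℓp (dirichletFeature a P z) 2) (k : ℕ+) :
    inner ℂ (⟨dirichletFeature a P z, h⟩ : PNatL2) (PNatL2.unit k) =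
      P.indicator (fun m : ℕ+ => (√(a m) : ℂ) * (m : ℂ) ^ (-z)) k := by
  rw [PNatL2.unit, lp.inner_single_right]
  change inner ℂ (dirichletFeature a P z k) (1 : ℂ) = _
  by_cases hk : k ∈ P
  · simp [dirichletFeature, hk]
  · simp [dirichletFeature, hk]

theorem PNat.natCast_cpow_sub_conj (m : ℕ+) (s u : ℂ) :
    (m : ℂ) ^ (-s - conj u) = (m : ℂ) ^ (-s) * conj ((m : ℂ) ^ (-u)) := by
  have hm : (m : ℂ) ≠ 0 := by exact_mod_cast m.ne_zero
  have h1 : (m : ℂ) ^ (conj (-u)) = conj ((conj (m : ℂ)) ^ (-u)) :=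
    Complex.cpow_conj _ _ (by rw [Complex.natCast_arg]; exact Real.pi_ne_zero.symm)
  rw [sub_eq_add_neg, Complex.cpow_add _ _ hm, ← map_neg, h1, Complex.conj_natCast]

theorem memℓp_dirichletFeature_univ {a : ℕ+ → ℝ} (ha : ∀ m, 0 < a m)
    (hconv : ∀ s u : halfPlane (1 / 2),
      Summable fun m : ℕ+ => (a m : ℂ) * (m : ℂ) ^ (-(s : ℂ) - conj (u : ℂ)))
    (u : halfPlane (1 / 2)) : Memℓp (dirichletFeature a Set.univ u) 2 := by
  refine memℓp_dirichletFeature ha ?_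
  refine (summable_subtype_iff_indicator
    (f := fun m : ℕ+ => a m * (m : ℝ) ^ (-(2 * (u : ℂ).re)))).mpr ?_
  rw [Set.indicator_univ]
  refine (hconv u u).norm.congr fun m => ?_
  rw [norm_mul, Complex.norm_natCast_cpow_of_pos m.pos, Complex.norm_real, Real.norm_eq_abs,
    abs_of_pos (ha m)]
  congr 2
  simp
  ring

theorem inner_dirichletFeature_univ {a : ℕ+ → ℝ} (ha : ∀ m, 0 < a m) {s u : halfPlane (1 / 2)}
    (hs : Memℓp (dirichletFeature a Set.univ s) 2) (hu : Memℓp (dirichletFeature a Set.univ u) 2) :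
    inner ℂ (⟨dirichletFeature a Set.univ s, hs⟩ : PNatL2) ⟨dirichletFeature a Set.univ u, hu⟩ =
      dirichletKernel a s u := by
  rw [← (inner_dirichletFeature_hasSum hs ⟨dirichletFeature a Set.univ u, hu⟩).tsum_eq,
    dirichletKernel, Matrix.of_apply]
  refine tsum_congr fun m => ?_
  rw [PNat.natCast_cpow_sub_conj, Set.indicator_univ]
  change (√(a m) : ℂ) * dirichletFeature a Set.univ u m * _ = _
  rw [dirichletFeature, Set.indicator_univ]
  have h1 : (√(a m) : ℂ) * √(a m) = a m := by exact_mod_cast Real.mul_self_sqrt (ha m).le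
  rw [← h1]
  ring

/-- Totality of the features: the pairings with `f` form a Dirichlet series with coefficients `√(a
m) * f m`, and uniqueness of coefficients applies. -/
theorem eq_zero_of_inner_dirichletFeature_univ {a : ℕ+ → ℝ} (ha : ∀ m, 0 < a m)
    (hmem : ∀ u : halfPlane (1 / 2), Memℓp (dirichletFeature a Set.univ u) 2) {f : PNatL2}
    (hf : ∀ u : halfPlane (1 / 2),
      inner ℂ (⟨dirichletFeature a Set.univ u, hmem u⟩ : PNatL2) f = 0) : f = 0 := by
  have h0 : (fun m : ℕ+ => (√(a m) : ℂ) * f m) = 0 := by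
    refine PNat.eq_zero_of_hasSum_dirichlet (δ := 1 / 2) fun x hx => ?_
    have hx' : (x : ℂ) ∈ halfPlane (1 / 2) := by simpa [halfPlane] using hx
    have := inner_dirichletFeature_hasSum (hmem ⟨x, hx'⟩) f
    rw [hf, Set.indicator_univ] at this
    exact this
  refine lp.ext (funext fun m => ?_)
  have h1 : (√(a m) : ℂ) ≠ 0 := by exact_mod_cast (Real.sqrt_pos.mpr (ha m)).ne'
  exact (mul_eq_zero.mp (congrFun h0 m)).resolve_left h1

/-! ### The symbol of a multiplier and its smooth truncations. -/

/-- The Dirichlet coefficients of the symbol of an operator acting as a multiplication. -/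
noncomputable def multiplierCoeff (a : ℕ+ → ℝ) (T : PNatL2 →L[ℂ] PNatL2) (m : ℕ+) : ℂ :=
  (√(a 1) : ℂ)⁻¹ * ((√(a m) : ℂ) * T (PNatL2.unit 1) m)

theorem hasSum_multiplierCoeff_indicator {a : ℕ+ → ℝ} (T : PNatL2 →L[ℂ] PNatL2) {P : Set ℕ+}
    {z : ℂ} (h : Memℓp (dirichletFeature a P z) 2) :
    HasSum (fun m => P.indicator (multiplierCoeff a T) m * (m : ℂ) ^ (-z))
      ((√(a 1) : ℂ)⁻¹ *
        inner ℂ (⟨dirichletFeature a P z, h⟩ : PNatL2) (T (PNatL2.unit 1))) := by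
  refine ((inner_dirichletFeature_hasSum h (T (PNatL2.unit 1))).mul_left
    (√(a 1) : ℂ)⁻¹).congr_fun fun m => ?_
  by_cases hm : m ∈ P
  · simp [hm, multiplierCoeff, mul_assoc]
  · simp [hm]

section Multiplier

variable {a : ℕ+ → ℝ} (ha : ∀ m, 0 < a m)
  (hmem : ∀ u : halfPlane (1 / 2), Memℓp (dirichletFeature a Set.univ u) 2)
  {T : PNatL2 →L[ℂ] PNatL2} {φ : halfPlane (1 / 2) → ℂ}
  (hT : ∀ (u : halfPlane (1 / 2)) (f : PNatL2), inner ℂ (⟨dirichletFeature a Set.univ u, hmem u⟩ : PNatL2) (T f) =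
    φ u * inner ℂ (⟨dirichletFeature a Set.univ u, hmem u⟩ : PNatL2) f)
include ha hT

theorem hasSum_multiplierCoeff (u : halfPlane (1 / 2)) :
    HasSum (fun m => multiplierCoeff a T m * (m : ℂ) ^ (-(u : ℂ))) (φ u) := by
  have h := hasSum_multiplierCoeff_indicator T (hmem u)
  have h1 : (√(a 1) : ℂ) ≠ 0 := by exact_mod_cast (Real.sqrt_pos.mpr (ha 1)).ne'
  rw [hT, inner_dirichletFeature_unit, Set.indicator_univ, Set.indicator_univ] at h
  convert h using 1
  simp
  field_simp

/-- The unit vector at `k` represents `√(a k) * k ^ (-s)`. Its product with `φ` has the coefficients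
of `φ` shifted to the multiples of `k`, so uniqueness of Dirichlet coefficients identifies the image
under `T`. -/
theorem sqrt_mul_apply_unit_eq_extend (k : ℕ+) :
    (fun m => (√(a m) : ℂ) * T (PNatL2.unit k) m) =
      Function.extend (fun l => k * l) (fun l => (√(a k) : ℂ) * multiplierCoeff a T l) 0 := by
  have hinj : Function.Injective fun l : ℕ+ => k * l := mul_right_injective k
  rw [← sub_eq_zero]
  refine PNat.eq_zero_of_hasSum_dirichlet (δ := 1 / 2) fun x hx => ?_
  have hx' : (x : ℂ) ∈ halfPlane (1 / 2) := by simpa [halfPlane] using hx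
  have h1 := inner_dirichletFeature_hasSum (hmem ⟨x, hx'⟩) (T (PNatL2.unit k))
  rw [hT, inner_dirichletFeature_unit, Set.indicator_univ, Set.indicator_univ] at h1
  have h2 : HasSum (fun m : ℕ+ => Function.extend (fun l => k * l)
      (fun l => (√(a k) : ℂ) * multiplierCoeff a T l) 0 m * (m : ℂ) ^ (-(x : ℂ)))
      ((√(a k) : ℂ) * (k : ℂ) ^ (-(x : ℂ)) * φ ⟨x, hx'⟩) := by
    rw [← hinj.hasSum_iff]
    · refine ((hasSum_multiplierCoeff ha hmem hT ⟨x, hx'⟩).mul_left _).congr_fun fun l => ?_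
      simp only [Function.comp_apply, hinj.extend_apply, PNat.mul_coe, Nat.cast_mul,
        Complex.natCast_mul_natCast_cpow]
      ring
    · rintro m hm
      rw [Function.extend_apply' _ _ _ hm]
      simp
  have h3 := h1.sub h2
  rw [mul_comm (φ _), sub_self] at h3
  refine h3.congr_fun fun m => ?_
  rw [Pi.sub_apply, sub_mul]

/-- The partial symbol over the smooth integers is an eigenvalue of the adjoint. -/
theorem adjoint_dirichletFeature_smooth {n : ℕ} {z : ℂ}
    (h : Memℓp (dirichletFeature a (smoothIntegers n) z) 2) :
    T.adjoint ⟨dirichletFeature a (smoothIntegers n) z, h⟩ =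
      conj (∑' m, (smoothIntegers n).indicator (multiplierCoeff a T) m * (m : ℂ) ^ (-z)) •
        (⟨dirichletFeature a (smoothIntegers n) z, h⟩ : PNatL2) := by
  refine PNatL2.ext_inner_unit fun k => ?_
  have hinj : Function.Injective fun l : ℕ+ => k * l := mul_right_injective k
  rw [ContinuousLinearMap.adjoint_inner_left, inner_smul_left, Complex.conj_conj,
    inner_dirichletFeature_unit]
  refine (inner_dirichletFeature_hasSum h (T (PNatL2.unit k))).unique ?_
  rw [sqrt_mul_apply_unit_eq_extend ha hmem hT k, ← hinj.hasSum_iff]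
  · have hs := (hasSum_multiplierCoeff_indicator T h).summable.hasSum
    refine (hs.mul_right ((smoothIntegers n).indicator
      (fun m : ℕ+ => (√(a m) : ℂ) * (m : ℂ) ^ (-z)) k)).congr_fun fun l => ?_
    -- As `k * l` is smooth exactly when both factors are, the truncated sum splits as a product.
    by_cases hk : k ∈ smoothIntegers n <;> by_cases hl : l ∈ smoothIntegers n <;>
      simp [Set.indicator, mul_mem_smoothIntegers_iff, hk, hl, hinj.extend_apply,
        Complex.natCast_mul_natCast_cpow]
    ring
  · rintro m hm
    by_cases hmP : m ∈ smoothIntegers n <;> simp [hmP, Function.extend_apply' _ _ _ hm]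

theorem norm_tsum_smooth_multiplierCoeff_le (hT1 : ‖T‖ ≤ 1) {n : ℕ} {z : ℂ}
    (h : Memℓp (dirichletFeature a (smoothIntegers n) z) 2) :
    ‖∑' m, (smoothIntegers n).indicator (multiplierCoeff a T) m * (m : ℂ) ^ (-z)‖ ≤ 1 := by
  -- The coordinate at `1` is `√(a 1)`, since `1` is always smooth.
  have hne : (⟨dirichletFeature a (smoothIntegers n) z, h⟩ : PNatL2) ≠ 0 := by
    intro h0
    have h1 := inner_dirichletFeature_unit h 1
    rw [h0, inner_zero_left, Set.indicator_of_mem (one_mem_smoothIntegers n)] at h1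
    have h2 : (√(a 1) : ℂ) ≠ 0 := by exact_mod_cast (Real.sqrt_pos.mpr (ha 1)).ne'
    exact h2 (by simpa using h1.symm)
  have h3 := T.adjoint.le_opNorm ⟨dirichletFeature a (smoothIntegers n) z, h⟩
  rw [adjoint_dirichletFeature_smooth ha hmem hT h, norm_smul, LinearIsometryEquiv.norm_map,
    Complex.norm_conj] at h3
  exact (le_of_mul_le_mul_right h3 (norm_pos_iff.mpr hne)).trans hT1

end Multiplier

/-! ### Passage to the limit and conclusion. -/

/-- The Schwarz–Pick inequality for the symbol of a contractive multiplier of a space of Dirichlet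
series. -/
theorem IsContractiveMultiplier.schwarz_pick_dirichlet {a : ℕ+ → ℝ} (ha : ∀ m, 0 < a m)
    (hsmooth : ∀ n : ℕ, 1 ≤ n → ∀ σ : ℝ, 0 < σ →
      Summable fun j : smoothIntegers n => a j * ((j : ℕ+) : ℝ) ^ (-σ))
    (hconv : ∀ s u : halfPlane (1 / 2),
      Summable fun m : ℕ+ => (a m : ℂ) * (m : ℂ) ^ (-(s : ℂ) - conj (u : ℂ)))
    {φ : halfPlane (1 / 2) → ℂ} (hφ : IsContractiveMultiplier
      (KernelSpace (dirichletKernel a) (dirichletKernel_posSemidef ha hconv)) φ)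
    {p z : halfPlane (1 / 2)} (hp : ‖φ p‖ < 1) :
    ‖φ z - φ p‖ * ‖conj (p : ℂ) + z‖ ≤ ‖(z : ℂ) - p‖ * ‖1 - conj (φ p) * φ z‖ := by
  have hmem := memℓp_dirichletFeature_univ ha hconv
  obtain ⟨T, hT1, hT⟩ := hφ.exists_contraction
    (v := fun u => (⟨dirichletFeature a Set.univ u, hmem u⟩ : PNatL2))
    (fun s u => inner_dirichletFeature_univ ha (hmem s) (hmem u))
    (fun f hf => eq_zero_of_inner_dirichletFeature_univ ha hmem hf)
  have hmemP : ∀ n : ℕ, 1 ≤ n → ∀ s : ℂ, 0 < s.re →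
      Memℓp (dirichletFeature a (smoothIntegers n) s) 2 := fun n hn s hs =>
    memℓp_dirichletFeature ha (hsmooth n hn (2 * s.re) (by positivity))
  let F : ℕ → ℂ → ℂ := fun n s =>
    ∑' m, (smoothIntegers n).indicator (multiplierCoeff a T) m * (m : ℂ) ^ (-s)
  have hlim : ∀ u : halfPlane (1 / 2),
      Filter.Tendsto (fun n => F n u) Filter.atTop (nhds (φ u)) := by
    intro u
    have hu := hasSum_multiplierCoeff ha hmem hT u
    rw [← hu.tsum_eq]
    -- Each coefficient is eventually untruncated, and the absolutely convergent series of `φ` at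
    -- `u` dominates.
    refine tendsto_tsum_of_dominated_convergence hu.summable.norm (fun m => ?_)
      (Filter.Eventually.of_forall fun n m => ?_)
    · refine tendsto_const_nhds.congr' ?_
      filter_upwards [eventually_mem_smoothIntegers m] with n hn
      rw [Set.indicator_of_mem hn]
    · rw [norm_mul, norm_mul]
      gcongr
      exact norm_indicator_le_norm_self _ _
  have hd : ∀ n, 1 ≤ n → DifferentiableOn ℂ (F n) {s | 0 < s.re} := by
    intro n hn
    have hs : ∀ s : ℂ, 0 < s.re → LSeriesHasSum
        (PNat.extendZero ((smoothIntegers n).indicator (multiplierCoeff a T))) s (F n s) :=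
      fun s hs => PNat.lseriesHasSum_extendZero_iff.mpr
        (hasSum_multiplierCoeff_indicator T (hmemP n hn s hs)).summable.hasSum
    have habs : LSeries.abscissaOfAbsConv
        (PNat.extendZero ((smoothIntegers n).indicator (multiplierCoeff a T))) ≤ 0 := by
      exact_mod_cast LSeries.abscissaOfAbsConv_le_of_forall_lt_LSeriesSummable (x := 0)
        fun y hy => (hs y (by simpa using hy)).LSeriesSummable
    refine ((LSeries_differentiableOn _).mono fun s hs => ?_).congr
      fun s hs' => (hs s hs').LSeries_eq.symm
    exact habs.trans_lt (by exact_mod_cast hs)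
  have hpos : ∀ u : halfPlane (1 / 2), 0 < (u : ℂ).re := fun u =>
    lt_trans (by norm_num) (show (1 / 2 : ℝ) < (u : ℂ).re from u.2)
  have hineq : ∀ᶠ n in Filter.atTop, ‖F n z - F n p‖ * ‖conj (p : ℂ) + z‖ ≤
      ‖(z : ℂ) - p‖ * ‖1 - conj (F n p) * F n z‖ := by
    -- Schwarz–Pick needs strict inequality at the base point, which `F n p` inherits from `φ p` for
    -- large `n`.
    filter_upwards [Filter.eventually_ge_atTop 1,
      (hlim p).norm.eventually_lt_const hp] with n hn hnp
    exact Complex.schwarz_pick_halfPlane (hd n hn)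
      (fun s hs => norm_tsum_smooth_multiplierCoeff_le ha hmem hT hT1 (hmemP n hn s hs))
      (hpos p) (hpos z) hnp
  refine le_of_tendsto_of_tendsto (((hlim z).sub (hlim p)).norm.mul_const _)
    (Filter.Tendsto.const_mul _ (tendsto_const_nhds.sub
      (((Complex.continuous_conj.tendsto _).comp (hlim p)).mul (hlim z))).norm) hineq

theorem proposition2p3 (a : ℕ+ → ℝ) (ha : ∀ m, 0 < a m)
    (hsmooth : ∀ n : ℕ, 1 ≤ n → ∀ σ : ℝ, 0 < σ →
      Summable fun j : smoothIntegers n => a j * ((j : ℕ+) : ℝ) ^ (-σ))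
    (hconv : ∀ s u : halfPlane (1 / 2),
      Summable fun m : ℕ+ => (a m : ℂ) * (m : ℂ) ^ (-(s : ℂ) - conj (u : ℂ)))
    (hpts : ∃ (lam : Fin 2 → halfPlane (1 / 2)) (w : Fin 2 → ℂ),
      lam 0 ≠ lam 1 ∧ (∀ i, ‖w i‖ < 1) ∧
      (Matrix.of fun i j : Fin 2 =>
        (1 - conj (w i) * w j) * dirichletKernel a (lam j) (lam i)).PosSemidef ∧
      ¬ (Matrix.of fun i j : Fin 2 =>
        (1 - conj (w i) * w j) / (conj (lam i : ℂ) + (lam j : ℂ))).PosSemidef) :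
    ¬ HasScalarPickProperty (dirichletKernel a) (dirichletKernel_posSemidef ha hconv) 2 := by
  intro hPick
  obtain ⟨lam, w, hne, hw, hpsd, hnot⟩ := hpts
  have hinj : Function.Injective lam := by
    intro i j hij
    fin_cases i <;> fin_cases j <;> first | rfl | exact absurd hij hne | exact absurd hij.symm hne
  obtain ⟨φ, hφ, hval⟩ := hPick lam w hinj hw (by
    -- The Pick property and the hypothesis index the matrix in opposite orders.
    refine (congrArg Matrix.PosSemidef ?_).mp hpsd.transpose
    ext i j
    simp [mul_comm (w _)])
  refine hnot (pickMatrix_halfPlane_posSemidef (lam := fun i => (lam i : ℂ)) (fun i =>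
    lt_trans (by norm_num) (show (1 / 2 : ℝ) < (lam i : ℂ).re from (lam i).2)) hw ?_)
  have h := hφ.schwarz_pick_dirichlet ha hsmooth hconv (p := lam 0) (z := lam 1)
    (by rw [hval]; exact hw 0)
  rwa [hval, hval] at h
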